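/- Consider the triangular lattice in the plane. A polyiamond is a finite nonempty set of triangular faces of the lattice that is edge-connected (two faces are adjacent if they share an edge; holes are allowed). Its area is the number of its faces, and its edge-perimeter $p(P)$ is the number of unit edges that separate a face of $P$ from a face not in $P$. For $r\ge 0$ and $0\le i\le 6$ let $E_{B_i}(r)$ be the set of faces obtained from the regular hexagon of side $r$ by moving $i$ of its bounding lines, consecutive in clockwise order, outwards by one lattice strip. For $r\ge1$ this attaches to the hexagon, one after the other in clockwise order, $i$ bars (rows) of triangles, which have successively $2r-1$, then four times $2r+1$, then $2r+3$ faces; $E_{B_6}(r)$ is the regular hexagon of side $r+1$. For $A\in\mathbb{N}$ put $r=\lfloor\sqrt{A/6}\rfloor$ and $l=A-6r^2$. If $l=0$ or $l<2r-1$ put $i=0$; otherwise let $i$ be the least $m\in\{1,2,3,4\}$ with $l<(2r-1)+m(2r+1)$ if there is one, and $i=5$ if there is none. Put $k=A-|E_{B_i}(r)|$. The standard polyiamond $S(A)$ is the union of $E_{B_i}(r)$ and the first $k$ faces, in clockwise order, of the next bar, i.e. the one that completes $E_{B_i}(r)$ to $E_{B_{i+1}}(r)$; it is determined by $A$ up to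 a lattice symmetry, and $S(0)=\emptyset$. Then for every $A\in\mathbb{N}$ the set $S(A)$ has area $A$ (and is a polyiamond if $A>0$), its edge-perimeter is $$p(S(A)) = 6r + i + \mathbb{1}_{\{k>0\}} + \mathbb{1}_{\{k>0,\ k\text{ even}\}},$$ and every polyiamond $P$ of area $A$ satisfies $p(P)\ge p(S(A))$. Hence standard polyiamonds minimize the edge-perimeter at fixed area. -/

import Mathlib

namespace Polyiamond

/-- A vertex of the triangular lattice: `(x, y)` stands for the point `x • e₁ + y • e₂` of the
plane, where `e₁ = (1, 0)` and `e₂ = (1/2, √3/2)`. -/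
abbrev Vertex : Type := ℤ × ℤ

/-- A triangular face of the lattice.  `(x, y, true)` is the upward triangle with corners
`(x, y), (x+1, y), (x, y+1)`; `(x, y, false)` is the downward triangle with corners
`(x+1, y), (x, y+1), (x+1, y+1)`. -/
abbrev Face : Type := ℤ × ℤ × Bool

/-- The three corners of a face. -/
def corners : Face → Finset Vertex
  | (x, y, true) => {(x, y), (x + 1, y), (x, y + 1)}
  | (x, y, false) => {(x + 1, y), (x, y + 1), (x + 1, y + 1)}

/-- The three unit edges of a face, an edge being the set of its two end points. -/
def edges (f : Face) : Finset (Finset Vertex) := (corners f).powersetCard 2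

/-- Two distinct faces are adjacent when they share an edge (a common corner is not enough). -/
def faceGraph : SimpleGraph Face where
  Adj f g := f ≠ g ∧ ∃ e, e ∈ edges f ∧ e ∈ edges g
  symm := ⟨fun _ _ h => ⟨h.1.symm, h.2.imp fun _ he => ⟨he.2, he.1⟩⟩⟩
  loopless := ⟨fun _ h => h.1 rfl⟩

/-- A polyiamond: a finite, nonempty, edge-connected set of faces.  Holes are allowed. -/
def IsPolyiamond (P : Finset Face) : Prop :=
  (faceGraph.induce (P : Set Face)).Connected

/-- The area is the number of faces. -/
def area (P : Finset Face) : ℕ := P.card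

open Classical in
/-- The boundary: the unit edges that separate a face in `P` from a face outside `P`. -/
noncomputable def boundary (P : Finset Face) : Finset (Finset Vertex) :=
  (P.biUnion edges).filter fun e => ∃ g : Face, g ∉ P ∧ e ∈ edges g

/-- The edge-perimeter. -/
noncomputable def perimeter (P : Finset Face) : ℕ := (boundary P).card

/-- The index of the strip `n ≤ x + y ≤ n + 1` that contains the face. -/
def diag : Face → ℤ
  | (x, y, true) => x + y
  | (x, y, false) => x + y + 1

/-- The quasi-regular hexagon made of the regular hexagon of radius `r` centred at the origin
(the faces whose three strip indices all lie in `[-r, r)`) and of `i ≤ 6` bars, attached one after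
the other to its sides in clockwise order, starting with the top side: each bar moves one of the
six bounding lines outwards by one unit. -/
noncomputable def quasiHexagon (r i : ℕ) : Finset Face :=
  (Finset.Icc (-(r : ℤ) - 1) r ×ˢ (Finset.Icc (-(r : ℤ) - 1) r ×ˢ Finset.univ)).filter fun f =>
    f.2.1 < (r : ℤ) + (if 1 ≤ i then 1 else 0) ∧
    diag f < (r : ℤ) + (if 2 ≤ i then 1 else 0) ∧
    f.1 < (r : ℤ) + (if 3 ≤ i then 1 else 0) ∧
    -(r : ℤ) - (if 4 ≤ i then 1 else 0) ≤ f.2.1 ∧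
    -(r : ℤ) - (if 5 ≤ i then 1 else 0) ≤ diag f ∧
    -(r : ℤ) - (if 6 ≤ i then 1 else 0) ≤ f.1

/-- The clockwise rotation by `π/3` about the origin, acting on faces.
On vertices it is `(x, y) ↦ (x + y, -x)`. -/
def rotate : Face → Face
  | (x, y, true) => (x + y, -x - 1, false)
  | (x, y, false) => (x + y + 1, -x - 1, true)

/-- The `n`-th face, counted clockwise (from left to right) from `n = 0`, of a bar lying on top of
the line `y = r`, whose larger base starts at the vertex `(s, r)`. -/
def topBarFace (r : ℕ) (s : ℤ) (n : ℕ) : Face :=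
  (s + (n / 2 : ℕ), (r : ℤ), decide (Even n))

/-- The first `k` faces, in clockwise order, of the bar that is attached to `quasiHexagon r i`
in order to build `quasiHexagon r (i + 1)`, for `i ≤ 5`.  It lies along the side obtained from the
top side by `i` rotations.  The larger base of the very first bar (`i = 0`) starts at the corner
`(-r, r)` of the hexagon; those of the following bars start one unit earlier, on the bar
attached just before. -/
def incompleteBar (r i k : ℕ) : Finset Face :=
  (Finset.range k).image fun n =>
    rotate^[i] (topBarFace r (if i = 0 then -(r : ℤ) else -(r : ℤ) - 1) n)

/-- The radius `r = ⌊√(A / 6)⌋`. -/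
def radius (A : ℕ) : ℕ := Nat.sqrt (A / 6)

/-- The number `i ∈ {0, …, 5}` of complete bars.  The bars attached successively to the regular
hexagon of radius `r` have `2r - 1`, then four times `2r + 1`, then `2r + 3` faces. -/
def barCount (A : ℕ) : ℕ :=
  let r : ℤ := radius A
  let l : ℤ := A - 6 * r ^ 2
  if l = 0 then 0
  else if l < 2 * r - 1 then 0
  else if l < (2 * r - 1) + (2 * r + 1) then 1
  else if l < (2 * r - 1) + 2 * (2 * r + 1) then 2
  else if l < (2 * r - 1) + 3 * (2 * r + 1) then 3
  else if l < (2 * r - 1) + 4 * (2 * r + 1) then 4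
  else 5

/-- The number `k` of faces in the last, incomplete bar: what remains of `A` after
the hexagon and the complete bars. -/
noncomputable def remainder (A : ℕ) : ℕ := A - area (quasiHexagon (radius A) (barCount A))

/-- The standard polyiamond `S(A)`. -/
noncomputable def standard (A : ℕ) : Finset Face :=
  quasiHexagon (radius A) (barCount A) ∪ incompleteBar (radius A) (barCount A) (remainder A)

end Polyiamond

/-! A strip of the lattice that meets `P` contributes at least two boundary edges, and each boundary
edge is counted in two of the three directions. Hence `P` meets at most `p(P)` strips altogether. If
the strips met in each direction are consecutive, `P` lies in a parallelogram from which two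
triangular corners are cut off, and counting faces gives `6 A ≤ p(P) ^ 2`. Otherwise a missed strip
splits `P` into two parts whose perimeters add up, and the inequality follows by induction. Since
`p(P)` and `A` have the same parity, a set with `(p - 2) ^ 2 < 6 A` has least perimeter; standard
polyiamonds have this property. Their perimeter is computed face by face: a new face changes it by
`3 - 2 d`, where `d` is the number of its neighbors already present, and after the first face of a
bar `d` alternates between `1` and `2`. -/

namespace Polyiamond

section Boundary

/-- The face on the other side of the `j`-th edge of a face. The edges of a face are numbered
so that the neighbor across the `j`-th edge lies in another strip only in the direction `j`, see
`strip`. -/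
def neighbor : Fin 3 → Face → Face
  | 0, (x, y, b) => (x, y, !b)
  | 1, (x, y, true) => (x - 1, y, false)
  | 1, (x, y, false) => (x + 1, y, true)
  | 2, (x, y, true) => (x, y - 1, false)
  | 2, (x, y, false) => (x, y + 1, true)

/-- The corner of a face opposite its `j`-th edge. -/
def corner : Fin 3 → Face → Vertex
  | 0, (x, y, true) => (x, y)
  | 1, (x, y, true) => (x + 1, y)
  | 2, (x, y, true) => (x, y + 1)
  | 0, (x, y, false) => (x + 1, y + 1)
  | 1, (x, y, false) => (x, y + 1)
  | 2, (x, y, false) => (x + 1, y)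

/-- The `j`-th edge of a face, as the set of its end points. -/
def edge (j : Fin 3) (f : Face) : Finset Vertex := (corners f).erase (corner j f)

theorem neighbor_involutive (j : Fin 3) : Function.Involutive (neighbor j) := by
  rintro ⟨x, y, b⟩
  fin_cases j <;> cases b <;> simp [neighbor]

theorem neighbor_ne (j : Fin 3) (f : Face) : neighbor j f ≠ f := by
  obtain ⟨x, y, b⟩ := f
  fin_cases j <;> cases b <;> simp [neighbor]

theorem neighbor_eq_iff {j : Fin 3} {f g : Face} : neighbor j g = f ↔ g = neighbor j f :=
  (neighbor_involutive j).eq_iff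

theorem mem_corners {v : Vertex} {f : Face} : v ∈ corners f ↔ ∃ j, corner j f = v := by
  obtain ⟨x, y, b⟩ := f
  cases b <;> simp [corners, corner, Fin.exists_fin_succ, eq_comm, or_comm, or_left_comm, or_assoc]

theorem card_corners (f : Face) : (corners f).card = 3 := by
  obtain ⟨x, y, b⟩ := f
  cases b <;> exact Finset.card_eq_three.2 ⟨_, _, _, by simp, by simp, by simp, rfl⟩

theorem mem_edges {e : Finset Vertex} {f : Face} : e ∈ edges f ↔ ∃ j, edge j f = e := by
  rw [edges, Finset.mem_powersetCard]
  constructor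
  · rintro ⟨hsub, hcard⟩
    obtain ⟨v, hv, h⟩ := Finset.exists_eq_insert_iff.2 ⟨hsub, by rw [hcard, card_corners]⟩
    obtain ⟨j, rfl⟩ := mem_corners.1 (h ▸ Finset.mem_insert_self v e)
    exact ⟨j, by rw [edge, ← h, Finset.erase_insert hv]⟩
  · rintro ⟨j, rfl⟩
    exact ⟨Finset.erase_subset _ _, by
      rw [edge, Finset.card_erase_of_mem (mem_corners.2 ⟨j, rfl⟩), card_corners]⟩

theorem edge_neighbor (j : Fin 3) (f : Face) : edge j (neighbor j f) = edge j f := by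
  obtain ⟨x, y, b⟩ := f
  ext v
  fin_cases j <;> cases b <;> simp [edge, corners, corner, neighbor] <;> grind

theorem sum_corners (x y : ℤ) (b : Bool) : ∑ v ∈ corners (x, y, b), v =
    if b then (3 * x + 1, 3 * y + 1) else (3 * x + 2, 3 * y + 2) := by
  cases b <;> simp [corners] <;> omega

theorem edge_eq_edge {i j : Fin 3} {f g : Face} (h : edge i f = edge j g) :
    i = j ∧ (g = f ∨ g = neighbor i f) := by
  -- An edge is determined by its midpoint, whose double is the sum of its end points.
  have hsum : ∑ v ∈ corners f, v - corner i f = ∑ v ∈ corners g, v - corner j g := by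
    rw [← Finset.sum_erase_eq_sub (mem_corners.2 ⟨i, rfl⟩),
      ← Finset.sum_erase_eq_sub (mem_corners.2 ⟨j, rfl⟩)]
    exact congrArg (fun e => ∑ v ∈ e, v) h
  obtain ⟨x, y, b⟩ := f
  obtain ⟨x', y', b'⟩ := g
  rw [sum_corners, sum_corners] at hsum
  fin_cases i <;> fin_cases j <;> cases b <;> cases b' <;>
    simp [corner, neighbor] at hsum ⊢ <;> omega

theorem faceGraph_adj {f g : Face} : faceGraph.Adj f g ↔ ∃ j, neighbor j f = g := by
  constructor
  · rintro ⟨hne, e, hf, hg⟩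
    obtain ⟨i, rfl⟩ := mem_edges.1 hf
    obtain ⟨j, hj⟩ := mem_edges.1 hg
    obtain ⟨-, h | h⟩ := edge_eq_edge hj.symm
    · exact absurd h.symm hne
    · exact ⟨i, h.symm⟩
  · rintro ⟨j, rfl⟩
    exact ⟨(neighbor_ne j f).symm, edge j f, mem_edges.2 ⟨j, rfl⟩,
      mem_edges.2 ⟨j, edge_neighbor j f⟩⟩

theorem isPolyiamond_singleton (f : Face) : IsPolyiamond {f} := by
  rw [IsPolyiamond, Finset.coe_singleton]
  exact SimpleGraph.Connected.of_subsingleton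

theorem IsPolyiamond.insert_of_neighbor_mem {P : Finset Face} {f : Face} {j : Fin 3}
    (hP : IsPolyiamond P) (hf : neighbor j f ∈ P) : IsPolyiamond (insert f P) := by
  rw [IsPolyiamond, Finset.coe_insert, ← Set.singleton_union, ← Finset.coe_singleton]
  exact SimpleGraph.connected_induce_union (isPolyiamond_singleton f).preconnected
    hP.preconnected (Finset.mem_coe.2 (Finset.mem_singleton_self f)) (Finset.mem_coe.2 hf)
    (faceGraph_adj.2 ⟨j, rfl⟩)

/-- The faces of `P` whose `j`-th edge belongs to the boundary of `P`. -/
def exposed (P : Finset Face) (j : Fin 3) : Finset Face := P.filter fun f => neighbor j f ∉ P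

theorem mem_exposed {P : Finset Face} {j : Fin 3} {f : Face} :
    f ∈ exposed P j ↔ f ∈ P ∧ neighbor j f ∉ P := Finset.mem_filter

theorem boundary_eq_image (P : Finset Face) :
    boundary P = (Finset.univ.sigma (exposed P)).image fun q => edge q.1 q.2 := by
  ext e
  simp only [boundary, Finset.mem_filter, Finset.mem_biUnion, Finset.mem_image,
    Finset.mem_sigma, Finset.mem_univ, true_and, Sigma.exists, mem_exposed]
  constructor
  · rintro ⟨⟨f, hf, he⟩, g, hg, he'⟩
    obtain ⟨i, rfl⟩ := mem_edges.1 he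
    obtain ⟨j, hj⟩ := mem_edges.1 he'
    obtain ⟨-, h | h⟩ := edge_eq_edge hj.symm
    · exact absurd (h ▸ hf) hg
    · exact ⟨i, f, ⟨hf, h ▸ hg⟩, rfl⟩
  · rintro ⟨j, f, ⟨hf, hg⟩, rfl⟩
    exact ⟨⟨f, hf, mem_edges.2 ⟨j, rfl⟩⟩, neighbor j f, hg, mem_edges.2 ⟨j, edge_neighbor j f⟩⟩

theorem perimeter_eq_sum (P : Finset Face) : perimeter P = ∑ j, (exposed P j).card := by
  rw [perimeter, boundary_eq_image, Finset.card_image_of_injOn, Finset.card_sigma]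
  rintro ⟨i, f⟩ hf ⟨j, g⟩ hg hfg
  simp only [Finset.coe_sigma, Set.mem_sigma_iff, Finset.mem_coe, mem_exposed] at hf hg
  obtain ⟨rfl, h | h⟩ := edge_eq_edge hfg
  · exact congrArg _ h.symm
  · exact absurd (h ▸ hg.2.1) hf.2.2

theorem perimeter_empty : perimeter ∅ = 0 := by simp [perimeter_eq_sum, exposed]

theorem perimeter_union {P Q : Finset Face} (hdisj : Disjoint P Q)
    (hPQ : ∀ f ∈ P, ∀ j, neighbor j f ∉ Q) :
    perimeter (P ∪ Q) = perimeter P + perimeter Q := by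
  have hQP : ∀ f ∈ Q, ∀ j, neighbor j f ∉ P := fun f hf j h =>
    hPQ _ h j (by rwa [neighbor_involutive j f])
  simp only [perimeter_eq_sum, ← Finset.sum_add_distrib]
  refine Finset.sum_congr rfl fun j _ => ?_
  have hsplit : exposed (P ∪ Q) j = exposed P j ∪ exposed Q j := by
    ext f
    have := hPQ f
    have := hQP f
    simp only [mem_exposed, Finset.mem_union]
    grind
  rw [hsplit]
  exact Finset.card_union_of_disjoint
    (hdisj.mono (Finset.filter_subset _ _) (Finset.filter_subset _ _))

theorem card_exposed_insert {P : Finset Face} {f : Face} (hf : f ∉ P) (j : Fin 3) :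
    (exposed (insert f P) j).card + (if neighbor j f ∈ P then 2 else 0) =
      (exposed P j).card + 1 := by
  have hne := neighbor_ne j
  have hiff := fun g => neighbor_eq_iff (j := j) (f := f) (g := g)
  split_ifs with h
  · have hP : exposed P j = insert (neighbor j f) (exposed (insert f P) j) := by
      ext g
      have := neighbor_involutive j f
      simp only [mem_exposed, Finset.mem_insert]
      grind
    rw [hP, Finset.card_insert_of_notMem (by simp [mem_exposed, neighbor_involutive j f])]
  · have hfP : exposed (insert f P) j = insert f (exposed P j) := by
      ext g
      simp only [mem_exposed, Finset.mem_insert]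
      grind
    rw [hfP, Finset.card_insert_of_notMem (by simp [mem_exposed, hf])]

theorem perimeter_insert {P : Finset Face} {f : Face} (hf : f ∉ P) :
    perimeter (insert f P) + 2 * (Finset.univ.filter fun j => neighbor j f ∈ P).card =
      perimeter P + 3 := by
  calc
    _ = ∑ j, ((exposed (insert f P) j).card + if neighbor j f ∈ P then 2 else 0) := by
      rw [Finset.sum_add_distrib, ← perimeter_eq_sum, Finset.card_filter, Finset.mul_sum]
      simp only [mul_ite, mul_one, mul_zero]
    _ = ∑ j, ((exposed P j).card + 1) :=
      Finset.sum_congr rfl fun j _ => card_exposed_insert hf j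
    _ = perimeter P + 3 := by
      simp only [Finset.sum_add_distrib, ← perimeter_eq_sum, Fin.sum_const, smul_eq_mul, mul_one]

theorem perimeter_mod_two (P : Finset Face) : perimeter P % 2 = area P % 2 := by
  induction P using Finset.induction_on with
  | empty => simp [perimeter_empty, area]
  | insert f P hf ih =>
    have := perimeter_insert hf
    rw [area] at ih ⊢
    rw [Finset.card_insert_of_notMem hf]
    omega

end Boundary

section Isoperimetry

/-- The index of the strip that contains a face, in each of the three directions. The offset in
direction `0` makes the three directions play symmetric roles: the three indices add up to `-1` on
upward and to `-2` on downward faces. -/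
def strip : Fin 3 → Face → ℤ
  | 0, f => -diag f - 1
  | 1, f => f.1
  | 2, f => f.2.1

theorem sum_strip (f : Face) :
    strip 0 f + strip 1 f + strip 2 f = if f.2.2 then -1 else -2 := by
  obtain ⟨x, y, b⟩ := f
  cases b <;> simp only [strip, diag, if_true, Bool.false_eq_true, if_false] <;> ring

theorem strip_neighbor (j k : Fin 3) (f : Face) :
    strip k (neighbor j f) = strip k f + if k = j then (if f.2.2 then -1 else 1) else 0 := by
  obtain ⟨x, y, b⟩ := f
  fin_cases j <;> fin_cases k <;> cases b <;> simp [strip, diag, neighbor] <;> omega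

theorem card_image_strip_le {i j k : Fin 3} (hij : i ≠ j) (hki : k ≠ i) (hkj : k ≠ j)
    (P : Finset Face) : (P.image (strip k)).card ≤
      (P.filter fun f => neighbor (if f.2.2 then i else j) f ∉ P).card := by
  -- Walking along a strip increases `strip j - strip i` by one at each step; the last face of `P`
  -- that is met has its successor outside `P`.
  refine le_trans (Finset.card_le_card fun m hm => ?_) (Finset.card_image_le (f := strip k))
  obtain ⟨f, hf, rfl⟩ := Finset.mem_image.1 hm
  obtain ⟨g, hg, hmax⟩ := (P.filter fun g => strip k g = strip k f).exists_max_image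
    (fun g => strip j g - strip i g) ⟨f, by simp [hf]⟩
  rw [Finset.mem_filter] at hg
  refine Finset.mem_image.2 ⟨g, Finset.mem_filter.2 ⟨hg.1, fun hnext => ?_⟩, hg.2⟩
  have := hmax _ (Finset.mem_filter.2 ⟨hnext, by
    rw [strip_neighbor, ← hg.2]
    split_ifs <;> simp_all⟩)
  rw [strip_neighbor, strip_neighbor] at this
  by_cases hup : g.2.2 <;>
    · simp only [hup, hij, hij.symm, if_true, if_false, Bool.false_eq_true] at this
      omega

theorem two_mul_card_image_strip_le {i j k : Fin 3} (hij : i ≠ j) (hki : k ≠ i) (hkj : k ≠ j)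
    (P : Finset Face) :
    2 * (P.image (strip k)).card ≤ (exposed P i).card + (exposed P j).card := by
  have hends := add_le_add (card_image_strip_le hij hki hkj P)
    (card_image_strip_le hij.symm hkj hki P)
  refine (two_mul _).trans_le (hends.trans_eq ?_)
  simp only [exposed, Finset.card_filter, ← Finset.sum_add_distrib]
  refine Finset.sum_congr rfl fun f _ => ?_
  by_cases hup : f.2.2 <;> simp [hup, add_comm]

theorem sum_card_image_strip_le_perimeter (P : Finset Face) :
    ∑ k, (P.image (strip k)).card ≤ perimeter P := by
  have h₀ := two_mul_card_image_strip_le (i := 1) (j := 2) (k := 0) (by simp) (by simp) (by simp) P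
  have h₁ := two_mul_card_image_strip_le (i := 0) (j := 2) (k := 1) (by simp) (by simp) (by simp) P
  have h₂ := two_mul_card_image_strip_le (i := 0) (j := 1) (k := 2) (by simp) (by simp) (by simp) P
  rw [perimeter_eq_sum, Fin.sum_univ_three, Fin.sum_univ_three]
  omega

/-- In each of the three directions, the strips that meet `P` are consecutive. -/
def StripConvex (P : Finset Face) : Prop :=
  ∀ k, ∀ f ∈ P, ∀ g ∈ P, ∀ m, strip k f < m → m < strip k g → ∃ h ∈ P, strip k h = m

theorem perimeter_filter_add_perimeter_filter {P : Finset Face} {k : Fin 3} {m : ℤ}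
    (hm : ∀ f ∈ P, strip k f ≠ m) :
    perimeter (P.filter fun f => strip k f < m) + perimeter (P.filter fun f => ¬strip k f < m) =
      perimeter P := by
  rw [← perimeter_union (Finset.disjoint_filter_filter_not _ _ _),
    Finset.filter_union_filter_not_eq]
  intro f hf j hj
  rw [Finset.mem_filter] at hf hj
  have hne := hm _ hj.1
  have hj' := hj.2
  rw [strip_neighbor] at hne hj'
  split_ifs at hne hj' <;> omega

theorem StripConvex.exists_extremes {P : Finset Face} (hP : StripConvex P) (hne : P.Nonempty)
    (k : Fin 3) : ∃ f ∈ P, ∃ g ∈ P, (∀ h ∈ P, strip k f ≤ strip k h ∧ strip k h ≤ strip k g) ∧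
      strip k g = strip k f + (P.image (strip k)).card - 1 := by
  obtain ⟨f, hf, hmin⟩ := P.exists_min_image (strip k) hne
  obtain ⟨g, hg, hmax⟩ := P.exists_max_image (strip k) hne
  have hfg := hmin g hg
  have himage : P.image (strip k) = Finset.Icc (strip k f) (strip k g) := by
    ext m
    rw [Finset.mem_image, Finset.mem_Icc]
    refine ⟨fun ⟨h, hh, hm⟩ => hm ▸ ⟨hmin h hh, hmax h hh⟩, fun ⟨hfm, hmg⟩ => ?_⟩
    rcases hfm.eq_or_lt with rfl | hfm
    · exact ⟨f, hf, rfl⟩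
    rcases hmg.eq_or_lt with rfl | hmg
    · exact ⟨g, hg, rfl⟩
    exact hP k f hf g hg m hfm hmg
  refine ⟨f, hf, g, hg, fun h hh => ⟨hmin h hh, hmax h hh⟩, ?_⟩
  rw [himage, Int.card_Icc]
  omega

/-- The faces of the lattice parallelogram with lowest corner `(x, y)`, with `a` unit edges in
direction `e₁` and `b` unit edges in direction `e₂`. -/
noncomputable def parallelogram (x y : ℤ) (a b : ℕ) : Finset Face :=
  Finset.Ico x (x + a) ×ˢ Finset.Ico y (y + b) ×ˢ Finset.univ

theorem mem_parallelogram {x y : ℤ} {a b : ℕ} {f : Face} : f ∈ parallelogram x y a b ↔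
    (x ≤ strip 1 f ∧ strip 1 f < x + a) ∧ y ≤ strip 2 f ∧ strip 2 f < y + b := by
  simp [parallelogram, strip]

theorem card_parallelogram (x y : ℤ) (a b : ℕ) : (parallelogram x y a b).card = a * (b * 2) := by
  simp [parallelogram]

theorem sq_le_card_corner {a b s : ℕ} (hsa : s ≤ a) (hsb : s ≤ b) (x y : ℤ) :
    s ^ 2 ≤ ((parallelogram x y a b).filter fun f => -x - y - s ≤ strip 0 f).card := by
  -- The upward faces come from the pairs with `p + q < s`, the downward ones from the others,
  -- counted from the opposite corner of the square.
  have hsquare : (Finset.range s ×ˢ Finset.range s).card = s ^ 2 := by simp [sq]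
  rw [← hsquare]
  refine Finset.card_le_card_of_injOn
    (fun q => if q.1 + q.2 < s then (x + q.1, y + q.2, true)
      else (x + (s - 1 - q.1), y + (s - 1 - q.2), false)) ?_ ?_
  · rintro ⟨p, q⟩ hpq
    simp only [Finset.coe_product, Finset.coe_range, Set.mem_prod, Set.mem_Iio] at hpq
    dsimp only
    split_ifs <;> simp [mem_parallelogram, strip, diag] <;> omega
  · rintro ⟨p, q⟩ - ⟨p', q'⟩ - heq
    dsimp only at heq
    split_ifs at heq <;> simp at heq ⊢ <;> omega

theorem sq_le_card_opposite_corner {a b t : ℕ} (hta : t ≤ a) (htb : t ≤ b) (x y : ℤ) :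
    t ^ 2 ≤ ((parallelogram x y a b).filter fun f => strip 0 f < t - x - y - a - b).card := by
  -- The point reflection in the centre of the parallelogram exchanges the two corners.
  refine (sq_le_card_corner hta htb x y).trans (Finset.card_le_card_of_injOn
    (fun f => (2 * x + a - 1 - f.1, 2 * y + b - 1 - f.2.1, !f.2.2)) ?_ ?_)
  · rintro ⟨p, q, c⟩ hf
    cases c <;> simp [mem_parallelogram, strip, diag] at hf ⊢ <;> omega
  · rintro ⟨p, q, c⟩ - ⟨p', q', c'⟩ - heq
    simpa using heq

theorem card_add_sq_add_sq_le {P : Finset Face} {x y : ℤ} {a b s t : ℕ} (hsa : s ≤ a)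
    (hsb : s ≤ b) (hta : t ≤ a) (htb : t ≤ b) (hP : P ⊆ parallelogram x y a b)
    (hstrip : ∀ f ∈ P, t - x - y - a - b ≤ strip 0 f ∧ strip 0 f < -x - y - s) :
    P.card + s ^ 2 + t ^ 2 ≤ a * (b * 2) := by
  refine (Nat.add_le_add (Nat.add_le_add_left (sq_le_card_corner hsa hsb x y) _)
    (sq_le_card_opposite_corner hta htb x y)).trans ?_
  rw [← Finset.card_union_of_disjoint, ← Finset.card_union_of_disjoint, ← card_parallelogram x y]
  · exact Finset.card_le_card (Finset.union_subset (Finset.union_subset hP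
      (Finset.filter_subset _ _)) (Finset.filter_subset _ _))
  all_goals
    rw [Finset.disjoint_left]
    intro f hf hf'
    have := hstrip f
    simp only [Finset.mem_union, Finset.mem_filter] at hf hf'
    grind

theorem six_mul_le_sq_of_add_sq_add_sq_le {n a b c s t : ℕ} (hst : s + t + c = a + b)
    (h : n + s ^ 2 + t ^ 2 ≤ a * (b * 2)) : 6 * n ≤ (c + a + b) ^ 2 := by
  zify at h hst ⊢
  have hc : (c : ℤ) = a + b - s - t := by linarith
  rw [hc]
  nlinarith [sq_nonneg ((s : ℤ) - t), sq_nonneg ((a : ℤ) - b),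
    sq_nonneg (2 * ((s : ℤ) + t) - a - b)]

theorem StripConvex.six_mul_card_le {P : Finset Face} (hP : StripConvex P) :
    6 * P.card ≤ (∑ k, (P.image (strip k)).card) ^ 2 := by
  rcases P.eq_empty_or_nonempty with rfl | hne
  · simp
  choose u hu v hv hbound hwidth using hP.exists_extremes hne
  have hsum : ∀ f, -2 ≤ strip 0 f + strip 1 f + strip 2 f ∧
      strip 0 f + strip 1 f + strip 2 f ≤ -1 := fun f => by
    rw [sum_strip]
    split_ifs <;> omega
  -- The extreme faces bound the sides of the two corners that the strips in direction `0` cut off.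
  have hextreme : ∀ k, _ ∧ _ := fun k =>
    ⟨And.intro (hsum (u k)) (fun i => hbound i _ (hu k)),
      And.intro (hsum (v k)) (fun i => hbound i _ (hv k))⟩
  have h₀ := hwidth 0
  have h₁ := hwidth 1
  have h₂ := hwidth 2
  rw [Fin.sum_univ_three]
  generalize (P.image (strip 0)).card = c at *
  generalize (P.image (strip 1)).card = a at *
  generalize (P.image (strip 2)).card = b at *
  simp only [Fin.forall_fin_succ, Fin.succ_zero_eq_one, Fin.succ_one_eq_two,
    IsEmpty.forall_iff, and_true] at hextreme
  obtain ⟨s, hs⟩ : ∃ s : ℕ, (s : ℤ) = -strip 1 (u 1) - strip 2 (u 2) - strip 0 (v 0) - 1 :=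
    ⟨_, Int.toNat_of_nonneg (by omega)⟩
  obtain ⟨t, ht⟩ : ∃ t : ℕ, (t : ℤ) = strip 0 (u 0) + strip 1 (v 1) + strip 2 (v 2) + 2 :=
    ⟨_, Int.toNat_of_nonneg (by omega)⟩
  refine six_mul_le_sq_of_add_sq_add_sq_le (s := s) (t := t) (by omega)
    (card_add_sq_add_sq_le (x := strip 1 (u 1)) (y := strip 2 (u 2)) (by omega) (by omega)
      (by omega) (by omega) (fun f hf => ?_) fun f hf => ?_)
  · have := hbound 1 f hf
    have := hbound 2 f hf
    rw [mem_parallelogram]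
    omega
  · have := hbound 0 f hf
    omega

theorem six_mul_area_le_sq_perimeter (P : Finset Face) : 6 * area P ≤ perimeter P ^ 2 := by
  induction P using Finset.strongInduction with | H P ih => ?_
  by_cases hP : StripConvex P
  · exact hP.six_mul_card_le.trans (Nat.pow_le_pow_left (sum_card_image_strip_le_perimeter P) 2)
  -- A missing strip cuts `P` into two parts without common edges.
  simp only [StripConvex, not_forall, not_exists, not_and] at hP
  obtain ⟨k, f, hf, g, hg, m, hfm, hmg, hm⟩ := hP
  have hbelow := ih (P.filter fun h => strip k h < m)
    (Finset.filter_ssubset.2 ⟨g, hg, hmg.not_gt⟩)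
  have habove := ih (P.filter fun h => ¬strip k h < m)
    (Finset.filter_ssubset.2 ⟨f, hf, not_not_intro hfm⟩)
  calc
    6 * area P = 6 * area (P.filter fun h => strip k h < m) +
        6 * area (P.filter fun h => ¬strip k h < m) := by
      rw [← mul_add, area, area, area, Finset.card_filter_add_card_filter_not]
    _ ≤ _ := add_le_add hbelow habove
    _ ≤ _ := pow_add_pow_le (Nat.zero_le _) (Nat.zero_le _) two_ne_zero
    _ = perimeter P ^ 2 := by rw [perimeter_filter_add_perimeter_filter hm]

theorem perimeter_le_of_sq_lt {P Q : Finset Face} (hP : ((perimeter P : ℤ) - 2) ^ 2 < 6 * area P)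
    (hPQ : area P = area Q) : perimeter P ≤ perimeter Q := by
  have hlt : (perimeter P : ℤ) - 2 < perimeter Q := by
    refine lt_of_pow_lt_pow_left₀ 2 (Int.natCast_nonneg _) (hP.trans_le ?_)
    exact_mod_cast hPQ ▸ six_mul_area_le_sq_perimeter Q
  have := perimeter_mod_two P
  have := perimeter_mod_two Q
  omega

end Isoperimetry
section Rotation

theorem neighbor_rotate (j : Fin 3) (f : Face) :
    neighbor (j + 1) (rotate f) = rotate (neighbor j f) := by
  obtain ⟨x, y, b⟩ := f
  fin_cases j <;> cases b <;> simp [neighbor, rotate] <;> omega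

theorem rotate_iterate_six : rotate^[6] = id := by
  funext ⟨x, y, b⟩
  cases b <;> simp [rotate] <;> omega

theorem rotate_bijective : Function.Bijective rotate := by
  refine Function.bijective_iff_has_inverse.2 ⟨rotate^[5], fun f => ?_, fun f => ?_⟩
  · exact congrFun rotate_iterate_six f
  · exact congrFun rotate_iterate_six f

theorem perimeter_image_rotate (P : Finset Face) : perimeter (P.image rotate) = perimeter P := by
  rw [perimeter_eq_sum, perimeter_eq_sum, ← Equiv.sum_comp (Equiv.addRight (1 : Fin 3))]
  refine Finset.sum_congr rfl fun j _ => ?_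
  have himage : exposed (P.image rotate) (j + 1) = (exposed P j).image rotate := by
    ext f
    obtain ⟨g, rfl⟩ := rotate_bijective.surjective f
    simp only [mem_exposed, neighbor_rotate, rotate_bijective.injective.mem_finset_image]
  rw [Equiv.coe_addRight, himage, Finset.card_image_of_injective _ rotate_bijective.injective]

theorem faceGraph_adj_rotate {f g : Face} (h : faceGraph.Adj f g) :
    faceGraph.Adj (rotate f) (rotate g) := by
  rw [faceGraph_adj] at h ⊢
  obtain ⟨j, rfl⟩ := h
  exact ⟨j + 1, neighbor_rotate j f⟩

theorem IsPolyiamond.image_rotate {P : Finset Face} (hP : IsPolyiamond P) :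
    IsPolyiamond (P.image rotate) := by
  rw [IsPolyiamond, Finset.coe_image]
  exact hP.map (SimpleGraph.induceHom ⟨rotate, faceGraph_adj_rotate⟩ (Set.mapsTo_image rotate P))
    (Set.surjective_mapsTo_image_restrict rotate P)

theorem IsPolyiamond.image_rotate_iterate {P : Finset Face} (hP : IsPolyiamond P) (n : ℕ) :
    IsPolyiamond (P.image rotate^[n]) := by
  induction n with
  | zero => rwa [Function.iterate_zero, Finset.image_id]
  | succ n ih => simpa only [Function.iterate_succ', Finset.image_image] using ih.image_rotate

theorem isPolyiamond_image_rotate_iterate_iff {P : Finset Face} {n : ℕ} :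
    IsPolyiamond (P.image rotate^[n]) ↔ IsPolyiamond P := by
  refine ⟨fun h => ?_, fun h => h.image_rotate_iterate n⟩
  have hid : rotate^[5 * n] ∘ rotate^[n] = id := by
    rw [← Function.iterate_add, ← Nat.succ_mul, Function.iterate_mul, rotate_iterate_six,
      Function.iterate_id]
  simpa only [Finset.image_image, hid, Finset.image_id] using h.image_rotate_iterate (5 * n)

theorem perimeter_image_rotate_iterate (P : Finset Face) (n : ℕ) :
    perimeter (P.image rotate^[n]) = perimeter P := by
  induction n with
  | zero => rw [Function.iterate_zero, Finset.image_id]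
  | succ n ih => rw [Function.iterate_succ', ← Finset.image_image, perimeter_image_rotate, ih]

theorem area_image_rotate_iterate (P : Finset Face) (n : ℕ) :
    area (P.image rotate^[n]) = area P :=
  Finset.card_image_of_injective P (rotate_bijective.injective.iterate n)

end Rotation

section Bar

/-- The first `k` faces of the bar on top of the line `y = r` that starts at the vertex `(s, r)`. -/
def topBar (r : ℕ) (s : ℤ) (k : ℕ) : Finset Face := (Finset.range k).image (topBarFace r s)

theorem topBar_succ (r : ℕ) (s : ℤ) (k : ℕ) :
    topBar r s (k + 1) = insert (topBarFace r s k) (topBar r s k) := by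
  rw [topBar, Finset.range_add_one, Finset.image_insert, topBar]

theorem mem_topBar {r k : ℕ} {s : ℤ} {f : Face} : f ∈ topBar r s k ↔
    f.2.1 = r ∧ s ≤ f.1 ∧ 2 * (f.1 - s) + (if f.2.2 then 0 else 1) < k := by
  obtain ⟨x, y, b⟩ := f
  simp only [topBar, Finset.mem_image, Finset.mem_range, topBarFace, Prod.mk.injEq]
  constructor
  · rintro ⟨n, hn, rfl, rfl, rfl⟩
    simp only [decide_eq_true_eq, Nat.even_iff, true_and]
    split_ifs <;> omega
  · rintro ⟨rfl, hs, hk⟩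
    obtain ⟨m, hm⟩ := Int.eq_ofNat_of_zero_le (sub_nonneg.2 hs)
    refine ⟨2 * m + (if b then 0 else 1), ?_, ?_, rfl, ?_⟩ <;>
      cases b <;> simp at hk ⊢ <;> omega

/-- `Q` lies below the line `y = r` and contains the faces on which the first `k` faces of the bar
`topBar r s` stand. -/
def Supports (Q : Finset Face) (r : ℕ) (s : ℤ) (k : ℕ) : Prop :=
  (∀ f ∈ Q, f.2.1 < r) ∧ ∀ m : ℕ, 2 * m < k → (s + m, (r : ℤ) - 1, false) ∈ Q

variable {Q : Finset Face} {r k : ℕ} {s : ℤ}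

theorem Supports.mono (h : Supports Q r s k) {l : ℕ} (hlk : l ≤ k) : Supports Q r s l :=
  ⟨h.1, fun m hm => h.2 m (hm.trans_le hlk)⟩

theorem topBarFace_notMem (hQ : ∀ f ∈ Q, f.2.1 < r) (s : ℤ) (n : ℕ) :
    topBarFace r s n ∉ Q ∪ topBar r s n := by
  rw [Finset.mem_union, mem_topBar, topBarFace]
  rintro (hmem | hbar)
  · exact (hQ _ hmem).false
  · simp only [decide_eq_true_eq, Nat.even_iff] at hbar
    omega

theorem Supports.neighbor_topBarFace_mem_iff {n : ℕ} (h : Supports Q r s (n + 1)) (j : Fin 3) :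
    neighbor j (topBarFace r s n) ∈ Q ∪ topBar r s n ↔
      j = 0 ∧ ¬Even n ∨ j = 1 ∧ Even n ∧ 0 < n ∨ j = 2 ∧ Even n := by
  have hQ : ∀ x y b, (r : ℤ) ≤ y → (x, y, b) ∉ Q := fun x y b hy hf => (h.1 _ hf).not_ge hy
  rcases n.even_or_odd' with ⟨m, rfl | rfl⟩
  · have := h.2 m (Nat.lt_succ_self _)
    fin_cases j <;> simp [topBarFace, neighbor, mem_topBar, hQ, this]
    omega
  · have : (2 * m + 1) / 2 = m := by omega
    fin_cases j <;> simp [topBarFace, neighbor, mem_topBar, hQ, this]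
    omega

/-- The perimeter gained by attaching `k` faces of a bar, clockwise, to a set that supports it. -/
def barGain (k : ℕ) : ℕ := (if 0 < k then 1 else 0) + (if 0 < k ∧ Even k then 1 else 0)

theorem barGain_succ (k : ℕ) :
    barGain (k + 1) + 2 * (if Even k ∧ 0 < k then 2 else 1) = barGain k + 3 := by
  simp only [barGain, Nat.even_iff]
  split_ifs <;> omega

theorem Supports.card_filter_neighbor {n : ℕ} (h : Supports Q r s (n + 1)) :
    (Finset.univ.filter fun j => neighbor j (topBarFace r s n) ∈ Q ∪ topBar r s n).card =
      if Even n ∧ 0 < n then 2 else 1 := by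
  simp only [h.neighbor_topBarFace_mem_iff]
  by_cases heven : Even n <;> by_cases hpos : 0 < n <;> simp [heven, hpos] <;> rfl

theorem area_union_topBar (hQ : ∀ f ∈ Q, f.2.1 < r) (s : ℤ) (k : ℕ) :
    area (Q ∪ topBar r s k) = area Q + k := by
  induction k with
  | zero => simp [topBar]
  | succ k ih =>
    rw [topBar_succ, Finset.union_insert, area,
      Finset.card_insert_of_notMem (topBarFace_notMem hQ s k), ← area, ih, add_assoc]

theorem Supports.perimeter_union_topBar (h : Supports Q r s k) :
    perimeter (Q ∪ topBar r s k) = perimeter Q + barGain k := by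
  induction k with
  | zero => simp [topBar, barGain]
  | succ k ih =>
    have hinsert := perimeter_insert (topBarFace_notMem h.1 s k)
    rw [h.card_filter_neighbor, ih (h.mono k.le_succ)] at hinsert
    have := barGain_succ k
    rw [topBar_succ, Finset.union_insert]
    omega

theorem Supports.isPolyiamond_union_topBar (h : Supports Q r s k) (hQ : IsPolyiamond Q) :
    IsPolyiamond (Q ∪ topBar r s k) := by
  induction k with
  | zero => simpa [topBar] using hQ
  | succ k ih =>
    rw [topBar_succ, Finset.union_insert]
    refine (ih (h.mono k.le_succ)).insert_of_neighbor_mem (j := if Even k then 2 else 0) ?_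
    rw [h.neighbor_topBarFace_mem_iff]
    split_ifs <;> simp_all

end Bar

section Hexagon

/-- The index, counted outwards from the centre, of the strip that contains a face, in the direction
of the `j`-th side of a hexagon. The sides are numbered clockwise from `0`, the top one. -/
def height : Fin 6 → Face → ℤ
  | 0, f => f.2.1
  | 1, f => diag f
  | 2, f => f.1
  | 3, f => -f.2.1 - 1
  | 4, f => -diag f - 1
  | 5, f => -f.1 - 1

theorem forall_height_lt_iff {b : Fin 6 → ℤ} {f : Face} : (∀ j, height j f < b j) ↔
    f.2.1 < b 0 ∧ diag f < b 1 ∧ f.1 < b 2 ∧ -b 3 ≤ f.2.1 ∧ -b 4 ≤ diag f ∧ -b 5 ≤ f.1 := by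
  simp only [Fin.forall_fin_succ, height, Fin.succ_zero_eq_one, Fin.succ_one_eq_two,
    Fin.reduceSucc, IsEmpty.forall_iff, and_true]
  omega

theorem mem_quasiHexagon {r i : ℕ} {f : Face} : f ∈ quasiHexagon r i ↔
    ∀ j, height j f < r + if (j : ℕ) < i then 1 else 0 := by
  have hbound (m : ℕ) : (if m ≤ i then 1 else 0 : ℤ) ≤ 1 := by split_ifs <;> decide
  have := hbound 1
  have := hbound 3
  have := hbound 4
  have := hbound 6
  simp only [quasiHexagon, Finset.mem_filter, Finset.mem_product, Finset.mem_Icc, Finset.mem_univ,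
    and_true, forall_height_lt_iff, Nat.lt_iff_add_one_le, Fin.coe_ofNat_eq_mod, Nat.reduceMod,
    Nat.reduceAdd]
  omega

theorem height_rotate (j : Fin 6) (f : Face) : height (j + 1) (rotate f) = height j f := by
  obtain ⟨x, y, b⟩ := f
  fin_cases j <;> cases b <;> simp [height, rotate, diag] <;> omega

theorem height_rotate_iterate (j : Fin 6) (i : ℕ) (f : Face) :
    height (j + Fin.ofNat 6 i) (rotate^[i] f) = height j f := by
  induction i with
  | zero => simp
  | succ i ih =>
    have hi : Fin.ofNat 6 (i + 1) = Fin.ofNat 6 i + 1 := by simp [Fin.ext_iff, Fin.val_add]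
    rw [Function.iterate_succ_apply', hi, ← add_assoc, height_rotate, ih]

theorem rotate_iterate_mem_quasiHexagon {r n i : ℕ} {f : Face} :
    rotate^[i] f ∈ quasiHexagon r n ↔
      ∀ j : Fin 6, height j f < r + if (j + i : ℕ) % 6 < n then 1 else 0 := by
  rw [mem_quasiHexagon, ← (Equiv.addRight (Fin.ofNat 6 i)).forall_congr_right]
  simp [-Fin.ofNat_eq_cast, Equiv.coe_addRight, height_rotate_iterate, Fin.val_add]

/-- The hexagon `quasiHexagon r i` turned in such a way that the next bar lies on top of it. -/
noncomputable def turnedHexagon (r i : ℕ) : Finset Face :=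
  (quasiHexagon r i).preimage rotate^[i] (rotate_bijective.injective.iterate i).injOn

theorem image_turnedHexagon (r i : ℕ) :
    (turnedHexagon r i).image rotate^[i] = quasiHexagon r i :=
  Finset.image_preimage_of_bijective _ (rotate_bijective.iterate i)

/-- The abscissa of the vertex at which the larger base of the bar on top of `turnedHexagon r i`
starts. -/
def barStart (r i : ℕ) : ℤ := if i = 0 then -r else -r - 1

/-- The number of faces of the bar that turns `quasiHexagon r i` into `quasiHexagon r (i + 1)`. For
`r = 0` the first three values are `-1, 1, 1`: only their sum, the number of faces of
`quasiHexagon 0 3`, is meaningful. -/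
def barLength (r i : ℕ) : ℤ :=
  if i = 0 then 2 * r - 1 else if i ≤ 4 then 2 * r + 1 else 2 * r + 3

theorem mem_turnedHexagon {r i : ℕ} {f : Face} : f ∈ turnedHexagon r i ↔
    ∀ j : Fin 6, height j f < r + if (j + i : ℕ) % 6 < i then 1 else 0 := by
  rw [turnedHexagon, Finset.mem_preimage, rotate_iterate_mem_quasiHexagon]

variable {r i k : ℕ}

-- The condition `3 ≤ 6 * r + i` leaves out the empty sets `quasiHexagon 0 i` with `i ≤ 2`.
theorem supports_turnedHexagon (hi : i ≤ 5) (hri : 3 ≤ 6 * r + i) (hk : k ≤ barLength r i) :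
    Supports (turnedHexagon r i) r (barStart r i) k := by
  constructor
  · intro f hf
    have := mem_turnedHexagon.1 hf 0
    simpa [height, Nat.mod_eq_of_lt (hi.trans_lt (Nat.lt_succ_self 5))] using this
  · intro m hm
    simp only [mem_turnedHexagon, barStart, barLength, forall_height_lt_iff] at hk ⊢
    interval_cases i <;> simp [diag] at hk ⊢ <;> omega

theorem quasiHexagon_union_incompleteBar (r i k : ℕ) : quasiHexagon r i ∪ incompleteBar r i k =
    (turnedHexagon r i ∪ topBar r (barStart r i) k).image rotate^[i] := by
  rw [Finset.image_union, image_turnedHexagon, topBar, Finset.image_image]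
  rfl

theorem quasiHexagon_succ (hi : i ≤ 5) (hri : 3 ≤ 6 * r + i) (hk : k = barLength r i) :
    quasiHexagon r (i + 1) = quasiHexagon r i ∪ incompleteBar r i k := by
  ext f
  obtain ⟨f, rfl⟩ := (rotate_bijective.iterate i).surjective f
  rw [quasiHexagon_union_incompleteBar, (rotate_bijective.injective.iterate i).mem_finset_image,
    Finset.mem_union, mem_topBar, mem_turnedHexagon, rotate_iterate_mem_quasiHexagon, hk]
  obtain ⟨x, y, b⟩ := f
  simp only [barStart, barLength, forall_height_lt_iff]
  interval_cases i <;> cases b <;> simp [diag] <;> omega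

theorem quasiHexagon_six (r : ℕ) : quasiHexagon r 6 = quasiHexagon (r + 1) 0 := by
  ext f
  simp [mem_quasiHexagon]

theorem quasiHexagon_zero_zero : quasiHexagon 0 0 = ∅ := by
  refine Finset.eq_empty_of_forall_notMem fun f => ?_
  simp only [mem_quasiHexagon, forall_height_lt_iff, Nat.not_lt_zero, if_false]
  omega

theorem quasiHexagon_zero_three : quasiHexagon 0 3 = {(0, 0, true)} := by
  ext ⟨x, y, b⟩
  cases b <;> simp [mem_quasiHexagon, forall_height_lt_iff, diag] <;> omega

theorem area_union_incompleteBar (hi : i ≤ 5) (hri : 3 ≤ 6 * r + i) (hk : k ≤ barLength r i) :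
    area (quasiHexagon r i ∪ incompleteBar r i k) = area (quasiHexagon r i) + k := by
  rw [quasiHexagon_union_incompleteBar, area_image_rotate_iterate,
    area_union_topBar (supports_turnedHexagon hi hri hk).1, ← image_turnedHexagon r i,
    area_image_rotate_iterate]

theorem perimeter_union_incompleteBar (hi : i ≤ 5) (hri : 3 ≤ 6 * r + i) (hk : k ≤ barLength r i) :
    perimeter (quasiHexagon r i ∪ incompleteBar r i k) =
      perimeter (quasiHexagon r i) + barGain k := by
  rw [quasiHexagon_union_incompleteBar, perimeter_image_rotate_iterate,
    (supports_turnedHexagon hi hri hk).perimeter_union_topBar, ← image_turnedHexagon r i,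
    perimeter_image_rotate_iterate]

theorem IsPolyiamond.union_incompleteBar (h : IsPolyiamond (quasiHexagon r i)) (hi : i ≤ 5)
    (hri : 3 ≤ 6 * r + i) (hk : k ≤ barLength r i) :
    IsPolyiamond (quasiHexagon r i ∪ incompleteBar r i k) := by
  rw [← image_turnedHexagon, isPolyiamond_image_rotate_iterate_iff] at h
  rw [quasiHexagon_union_incompleteBar, isPolyiamond_image_rotate_iterate_iff]
  exact (supports_turnedHexagon hi hri hk).isPolyiamond_union_topBar h

theorem hexagon_induction {motive : ℕ → ℕ → Prop} (base : motive 0 3)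
    (bar : ∀ r i, i ≤ 5 → 3 ≤ 6 * r + i → motive r i → motive r (i + 1))
    (wrap : ∀ r, motive r 6 → motive (r + 1) 0)
    (hi : i ≤ 6) (hri : 3 ≤ 6 * r + i) : motive r i := by
  induction r generalizing i with
  | zero =>
    induction i, (by omega : 3 ≤ i) using Nat.le_induction with
    | base => exact base
    | succ i h3 ih => exact bar 0 i (by omega) (by omega) (ih (by omega) (by omega))
  | succ r ih =>
    induction i with
    | zero => exact wrap r (ih le_rfl (by omega))
    | succ i ihi => exact bar (r + 1) i (by omega) (by omega) (ihi (by omega) (by omega))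

theorem exists_barLength_eq_two_mul_add_one (hri : 3 ≤ 6 * r + i) :
    ∃ m : ℕ, (2 * m + 1 : ℕ) = barLength r i := by
  rw [barLength]
  split_ifs
  · exact ⟨r - 1, by omega⟩
  · exact ⟨r, by omega⟩
  · exact ⟨r + 1, by omega⟩

theorem isPolyiamond_quasiHexagon (hi : i ≤ 6) (hri : 3 ≤ 6 * r + i) :
    IsPolyiamond (quasiHexagon r i) := by
  refine hexagon_induction (motive := fun r i => IsPolyiamond (quasiHexagon r i))
    ?_ (fun r i hi hri ih => ?_) (fun r ih => ?_) hi hri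
  · exact quasiHexagon_zero_three ▸ isPolyiamond_singleton _
  · obtain ⟨m, hm⟩ := exists_barLength_eq_two_mul_add_one hri
    exact quasiHexagon_succ hi hri hm ▸ ih.union_incompleteBar hi hri hm.le
  · exact quasiHexagon_six r ▸ ih

/-- The number of faces of `quasiHexagon r i`, as the sum over the regular hexagon and the attached
bars. -/
def quasiArea (r i : ℕ) : ℤ := 6 * r ^ 2 + ∑ j ∈ Finset.range i, barLength r j

theorem area_quasiHexagon (hi : i ≤ 6) (hri : 3 ≤ 6 * r + i) :
    area (quasiHexagon r i) = quasiArea r i := by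
  refine hexagon_induction (motive := fun r i => area (quasiHexagon r i) = quasiArea r i)
    ?_ (fun r i hi hri ih => ?_) (fun r ih => ?_) hi hri
  · simp [quasiHexagon_zero_three, area, quasiArea, barLength, Finset.sum_range_succ]
  · obtain ⟨m, hm⟩ := exists_barLength_eq_two_mul_add_one hri
    rw [quasiHexagon_succ hi hri hm, area_union_incompleteBar hi hri hm.le, Nat.cast_add, ih, hm,
      quasiArea, quasiArea, Finset.sum_range_succ, add_assoc]
  · rw [← quasiHexagon_six, ih]
    simp only [quasiArea, barLength, Finset.sum_range_succ, Finset.sum_range_zero, Nat.reduceLeDiff,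
      OfNat.ofNat_ne_zero, one_ne_zero, ↓reduceIte, Nat.cast_succ]
    ring

theorem perimeter_quasiHexagon (hi : i ≤ 6) (hri : 3 ≤ 6 * r + i) :
    perimeter (quasiHexagon r i) = 6 * r + i := by
  refine hexagon_induction (motive := fun r i => perimeter (quasiHexagon r i) = 6 * r + i)
    ?_ (fun r i hi hri ih => ?_) (fun r ih => ?_) hi hri
  · rw [quasiHexagon_zero_three, ← insert_empty_eq]
    simpa [perimeter_empty] using perimeter_insert (Finset.notMem_empty ((0, 0, true) : Face))
  · obtain ⟨m, hm⟩ := exists_barLength_eq_two_mul_add_one hri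
    rw [quasiHexagon_succ hi hri hm, perimeter_union_incompleteBar hi hri hm.le, ih]
    simp [barGain, add_assoc]
  · rw [← quasiHexagon_six, ih]
    ring

theorem sq_le_six_mul_quasiArea_add (hi : i ≤ 5) :
    (6 * r + i : ℤ) ^ 2 ≤ 6 * quasiArea r i + 7 := by
  -- The two sides differ by `7, 0, 3, 4, 3, 0` for `i = 0, …, 5`.
  interval_cases i <;> simp [quasiArea, barLength, Finset.sum_range_succ] <;> linarith

theorem sq_lt_six_mul_quasiArea_add (hi : i ≤ 5) (hri : 3 ≤ 6 * r + i) (k : ℕ) :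
    ((6 * r + i + barGain k : ℕ) - 2 : ℤ) ^ 2 < 6 * (quasiArea r i + k) := by
  have harea := sq_le_six_mul_quasiArea_add (r := r) hi
  have hgain : barGain k = 0 ∨ barGain k = 1 ∧ 1 ≤ k ∨ barGain k = 2 ∧ 2 ≤ k := by
    simp only [barGain, Nat.even_iff]
    split_ifs <;> omega
  zify at hri hgain
  push_cast
  rcases hgain with h | ⟨h, hk⟩ | ⟨h, hk⟩ <;> rw [h] <;> nlinarith

end Hexagon

section Standard

theorem radius_spec (A : ℕ) : 6 * radius A ^ 2 ≤ A ∧ A < 6 * (radius A + 1) ^ 2 := by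
  have hle := Nat.sqrt_le' (A / 6)
  have hlt := Nat.lt_succ_sqrt' (A / 6)
  rw [Nat.succ_eq_add_one] at hlt
  rw [radius]
  omega

theorem barCount_spec {A : ℕ} (hA : 0 < A) : barCount A ≤ 5 ∧ 3 ≤ 6 * radius A + barCount A ∧
    quasiArea (radius A) (barCount A) ≤ A ∧ A < quasiArea (radius A) (barCount A + 1) := by
  obtain ⟨hle, hlt⟩ := radius_spec A
  have hsq : (radius A + 1) ^ 2 = radius A ^ 2 + 2 * radius A + 1 := by ring
  zify at hle hlt hsq hA
  have hzero : (radius A : ℤ) = 0 → (radius A : ℤ) ^ 2 = 0 := by simp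
  rw [hsq] at hlt
  simp only [barCount]
  split_ifs <;> simp [quasiArea, barLength, Finset.sum_range_succ] <;> omega

theorem natCast_remainder {A : ℕ} (hA : 0 < A) :
    (remainder A : ℤ) = A - quasiArea (radius A) (barCount A) := by
  obtain ⟨hi, hri, hle, -⟩ := barCount_spec hA
  rw [← area_quasiHexagon (by omega) hri] at hle ⊢
  rw [remainder]
  omega

theorem remainder_le_barLength {A : ℕ} (hA : 0 < A) :
    remainder A ≤ barLength (radius A) (barCount A) := by
  have hlt := (barCount_spec hA).2.2.2
  rw [quasiArea, Finset.sum_range_succ, ← add_assoc, ← quasiArea] at hlt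
  have := natCast_remainder hA
  omega

theorem radius_zero : radius 0 = 0 := Nat.sqrt_zero

theorem barCount_zero : barCount 0 = 0 := by simp [barCount, radius_zero]

theorem remainder_zero : remainder 0 = 0 := Nat.zero_sub _

theorem standard_zero : standard 0 = ∅ := by
  simp [standard, remainder_zero, radius_zero, barCount_zero, quasiHexagon_zero_zero, incompleteBar]

theorem isPolyiamond_standard {A : ℕ} (hA : 0 < A) : IsPolyiamond (standard A) := by
  obtain ⟨hi, hri, -⟩ := barCount_spec hA
  exact (isPolyiamond_quasiHexagon (by omega) hri).union_incompleteBar hi hri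
    (remainder_le_barLength hA)

theorem area_standard (A : ℕ) : area (standard A) = A := by
  rcases A.eq_zero_or_pos with rfl | hA
  · rw [standard_zero, area, Finset.card_empty]
  obtain ⟨hi, hri, -⟩ := barCount_spec hA
  rw [standard, area_union_incompleteBar hi hri (remainder_le_barLength hA)]
  have := area_quasiHexagon (by omega) hri
  have := natCast_remainder hA
  omega

theorem perimeter_standard (A : ℕ) :
    perimeter (standard A) = 6 * radius A + barCount A + barGain (remainder A) := by
  rcases A.eq_zero_or_pos with rfl | hA
  · simp [standard_zero, perimeter_empty, radius_zero, barCount_zero, remainder_zero, barGain]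
  obtain ⟨hi, hri, -⟩ := barCount_spec hA
  rw [standard, perimeter_union_incompleteBar hi hri (remainder_le_barLength hA),
    perimeter_quasiHexagon (by omega) hri]

theorem perimeter_standard_le (P : Finset Face) : perimeter (standard (area P)) ≤ perimeter P := by
  rcases (area P).eq_zero_or_pos with hP | hP
  · rw [hP, standard_zero, perimeter_empty]
    exact Nat.zero_le _
  obtain ⟨hi, hri, -⟩ := barCount_spec hP
  refine perimeter_le_of_sq_lt ?_ (area_standard _)
  have hsq := sq_lt_six_mul_quasiArea_add hi hri (remainder (area P))
  rw [natCast_remainder hP, add_sub_cancel, ← perimeter_standard] at hsq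
  rwa [area_standard]

end Standard

end Polyiamond

theorem theorem1_general (A : ℕ) :
    (0 < A → Polyiamond.IsPolyiamond (Polyiamond.standard A)) ∧
    Polyiamond.area (Polyiamond.standard A) = A ∧
    Polyiamond.perimeter (Polyiamond.standard A) =
      6 * Polyiamond.radius A + Polyiamond.barCount A
        + (if 0 < Polyiamond.remainder A then 1 else 0)
        + (if 0 < Polyiamond.remainder A ∧ Even (Polyiamond.remainder A) then 1 else 0) ∧
    ∀ P : Finset Polyiamond.Face, Polyiamond.area P = A →
      Polyiamond.perimeter (Polyiamond.standard A) ≤ Polyiamond.perimeter P :=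
  ⟨Polyiamond.isPolyiamond_standard, Polyiamond.area_standard A,
    (Polyiamond.perimeter_standard A).trans (Nat.add_assoc _ _ _).symm,
    fun P hP => hP ▸ Polyiamond.perimeter_standard_le P⟩

theorem theorem1 (A : ℕ) :
    (0 < A → Polyiamond.IsPolyiamond (Polyiamond.standard A)) ∧
    Polyiamond.area (Polyiamond.standard A) = A ∧
    Polyiamond.perimeter (Polyiamond.standard A) =
      6 * Polyiamond.radius A + Polyiamond.barCount A
        + (if 0 < Polyiamond.remainder A then 1 else 0)
        + (if 0 < Polyiamond.remainder A ∧ Even (Polyiamond.remainder A) then 1 else 0) ∧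
    ∀ P : Finset Polyiamond.Face, Polyiamond.IsPolyiamond P → Polyiamond.area P = A →
      Polyiamond.perimeter (Polyiamond.standard A) ≤ Polyiamond.perimeter P := by
  obtain ⟨hpolyiamond, harea, hperimeter, hmin⟩ := theorem1_general A
  exact ⟨hpolyiamond, harea, hperimeter, fun P _ hP => hmin P hP⟩
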